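/- Let $0<\alpha<1$ and $0<\beta<1/2$. Let $(P_i)_{i\ge 0}$ be an $\alpha$-random walk on $\mathbb{N}$, that is, $P_0=0$ and $P_i=P_{i-1}+W_i$ for $i\ge 1$, where $W_1,W_2,\dots$ are independent random variables, each equal to $1$ with probability $\alpha$ and to $0$ with probability $1-\alpha$. For $n\ge 1$ let $$\mathcal{V}^c(n)=\Big\{m\in\mathbb{N}: m\le n,\ \gcd\Big(m,\prod_{p\le \exp((\log n)^\beta)}p\Big)=1\Big\},\qquad c_n=\prod_{p\le \exp((\log n)^\beta)}\Big(1-\frac1p\Big),$$ where $p$ runs over primes, and let $$\overline{S}_n(\mathcal{V}^c(n))=\frac1n\,\#\{1\le i\le n: P_i\in\mathcal{V}^c(n)\}$$ be the proportion of the first $n$ steps that the walk spends in $\mathcal{V}^c(n)$. Then, almost surely, $$\overline{S}_n(\mathcal{V}^c(n))=c_n\,(1+o(1))\qquad (n\to\infty).$$ -/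

import Mathlib

open Filter Asymptotics MeasureTheory ProbabilityTheory

noncomputable section

/-- `P` is an `α`-random walk in `ℕ` starting at `0`: its increments are independent
Bernoulli variables, each equal to `1` with probability `α` and to `0` with probability `1 - α`.
(The increment from time `i` to time `i + 1` is written `W i`.) -/
def IsAlphaRandomWalk {Ω : Type*} [MeasurableSpace Ω] (μ : Measure Ω) (α : ℝ)
    (P : ℕ → Ω → ℕ) : Prop :=
  ∃ W : ℕ → Ω → ℕ,
    (∀ i, Measurable (W i)) ∧
    iIndepFun W μ ∧
    (∀ i, μ {ω | W i ω = 1} = ENNReal.ofReal α) ∧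
    (∀ i, μ {ω | W i ω = 0} = ENNReal.ofReal (1 - α)) ∧
    (∀ ω, P 0 ω = 0) ∧
    (∀ i ω, P (i + 1) ω = P i ω + W i ω)

/-- The primes `p ≤ exp ((log x) ^ β)`. -/
def smallPrimes (β x : ℝ) : Finset ℕ :=
  (Finset.range (⌊Real.exp (Real.log x ^ β)⌋₊ + 1)).filter Nat.Prime

/-- The set `V^c(x)` of all `m ≤ x` coprime to the product of the primes
`p ≤ exp ((log x) ^ β)`. -/
def sievedSet (β x : ℝ) : Set ℕ :=
  {m : ℕ | (m : ℝ) ≤ x ∧ Nat.Coprime m (∏ p ∈ smallPrimes β x, p)}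

/-- `c_x = ∏_{p ≤ exp ((log x) ^ β)} (1 - 1 / p)`. -/
def sieveDensity (β x : ℝ) : ℝ :=
  ∏ p ∈ smallPrimes β x, (1 - (p : ℝ)⁻¹)

/-- The proportion `(X_1 + ⋯ + X_n) / n` of the times `1, …, n` at which the path `P` is in `V`,
where `X_i` is `1` if `P i ∈ V` and `0` otherwise. -/
def visitProportion (P : ℕ → ℕ) (V : Set ℕ) (n : ℕ) : ℝ :=
  (∑ i ∈ Finset.Icc 1 n, V.indicator (fun _ => (1 : ℝ)) (P i)) / n

end

/-! ### The Legendre sieve with Rankin's trick -/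

/-! Write `L = log n`, `V` for the sieved set and `c` for its density. The walk leaves each site `m
< P n` exactly once, so the sum over `i < n` of `1_V(P i) * W i` is the number of elements of `V`
below `P n` (`sum_indicator_mul_step`). Replacing `W i` by `α` costs the martingale
`centredStepSum`, which is sub-Gaussian with variance proxy `n / 4`. By Borel–Cantelli it is
eventually below `n ^ (3/4)`, even though `V` changes with `n`. Taking `V = univ` also gives `P n =
α n + O(n ^ (3/4))`.

It remains to count `V` up to `x ≤ n`. Legendre's sieve with Rankin's trick gives `x c + O(n exp(3
L^β - L^(1-β)))` (`abs_card_coprime_smallPrimes_sub_le`). Since `c ≥ exp(-L^β)`, the relative errors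
are of order `exp(4 L^β - L^(1-β))` and `exp(L^β - L/4)`. Both vanish because `β < 1 - β`. -/

lemma indicator_coprime_prod_eq_sum (S : Finset ℕ) (hS : ∀ p ∈ S, p.Prime) (m : ℕ) :
    (if Nat.Coprime m (∏ p ∈ S, p) then (1 : ℝ) else 0)
      = ∑ T ∈ S.powerset, (-1 : ℝ) ^ T.card * (if (∏ p ∈ T, p) ∣ m then 1 else 0) := by
  have h1 : ∀ T ∈ S.powerset, (-1 : ℝ) ^ T.card * (if (∏ p ∈ T, p) ∣ m then 1 else 0)
      = ∏ p ∈ T, (if p ∣ m then (-1 : ℝ) else 0) := by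
    intro T hT
    have hdvd : (∏ p ∈ T, p) ∣ m ↔ ∀ p ∈ T, p ∣ m :=
      ⟨fun h p hp => (Finset.dvd_prod_of_mem _ hp).trans h, fun h =>
        Finset.prod_primes_dvd m (fun p hp => (hS p (Finset.mem_powerset.1 hT hp)).prime) h⟩
    by_cases h : ∀ p ∈ T, p ∣ m
    · rw [if_pos (hdvd.2 h), Finset.prod_congr rfl (fun p hp => if_pos (h p hp))]
      simp
    · rw [if_neg (fun h' => h (hdvd.1 h'))]
      push Not at h
      obtain ⟨p, hp, hpm⟩ := h
      rw [Finset.prod_eq_zero hp (if_neg hpm), mul_zero]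
  rw [Finset.sum_congr rfl h1, ← Finset.prod_one_add]
  by_cases h : ∃ p ∈ S, p ∣ m
  · obtain ⟨p, hp, hpm⟩ := h
    rw [if_neg, Finset.prod_eq_zero hp (by simp [hpm])]
    rw [Nat.coprime_prod_right_iff]
    intro hc
    exact ((hS p hp).coprime_iff_not_dvd.1 (hc p hp).symm) hpm
  · push Not at h
    rw [if_pos, Finset.prod_eq_one]
    · intro p hp
      simp [h p hp]
    · rw [Nat.coprime_prod_right_iff]
      exact fun p hp => ((hS p hp).coprime_iff_not_dvd.2 (h p hp)).symm

/-- Rankin's trick: the fractional part is at most `min 1 (x / d)`, hence at most any power of `x /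
d` with exponent in `[0, 1]`. Unlike the bound `1`, this is multiplicative in `d`, so the errors
over all divisors sum to an Euler product. -/
lemma abs_natDiv_sub_div_le_rpow (x d : ℕ) (hd : 0 < d) {σ : ℝ} (h0 : 0 ≤ σ) (h1 : σ ≤ 1) :
    |((x / d : ℕ) : ℝ) - (x : ℝ) / d| ≤ ((x : ℝ) / d) ^ σ := by
  have hle : ((x / d : ℕ) : ℝ) ≤ (x : ℝ) / d := Nat.cast_div_le
  have hq : (0 : ℝ) ≤ (x : ℝ) / d := by positivity
  have hlt : (x : ℝ) / d < ((x / d : ℕ) : ℝ) + 1 := by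
    rw [div_lt_iff₀ (by positivity)]
    exact_mod_cast Nat.lt_mul_of_div_lt (Nat.lt_succ_self _) hd
  rw [abs_sub_comm, abs_of_nonneg (by linarith)]
  rcases le_total 1 ((x : ℝ) / d) with h | h
  · linarith [Real.one_le_rpow h h0]
  · have : ((x : ℝ) / d) ^ (1 : ℝ) ≤ ((x : ℝ) / d) ^ σ := by
      rcases hq.eq_or_lt with h' | h'
      · rw [← h', Real.zero_rpow one_ne_zero]
        exact Real.rpow_nonneg le_rfl _
      · exact Real.rpow_le_rpow_of_exponent_ge h' h h1
    rw [Real.rpow_one] at this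
    linarith [Nat.cast_nonneg (α := ℝ) (x / d)]

lemma abs_card_coprime_sub_le (S : Finset ℕ) (hS : ∀ p ∈ S, p.Prime) (x : ℕ) {σ : ℝ}
    (h0 : 0 ≤ σ) (h1 : σ ≤ 1) :
    |(∑ m ∈ Finset.Ioc 0 x, if Nat.Coprime m (∏ p ∈ S, p) then (1 : ℝ) else 0)
        - x * ∏ p ∈ S, (1 - (p : ℝ)⁻¹)| ≤ (x : ℝ) ^ σ * ∏ p ∈ S, (1 + ((p : ℝ)⁻¹) ^ σ) := by
  have hA : (∑ m ∈ Finset.Ioc 0 x, if Nat.Coprime m (∏ p ∈ S, p) then (1 : ℝ) else 0)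
      = ∑ T ∈ S.powerset, (-1 : ℝ) ^ T.card * ((x / ∏ p ∈ T, p : ℕ) : ℝ) := by
    simp_rw [indicator_coprime_prod_eq_sum S hS]
    rw [Finset.sum_comm]
    refine Finset.sum_congr rfl fun T _ => ?_
    rw [← Finset.mul_sum, Finset.sum_boole, Nat.Ioc_filter_dvd_card_eq_div]
  have hB : (x : ℝ) * ∏ p ∈ S, (1 - (p : ℝ)⁻¹)
      = ∑ T ∈ S.powerset, (-1 : ℝ) ^ T.card * ((x : ℝ) / (∏ p ∈ T, p : ℕ)) := by
    simp_rw [sub_eq_add_neg]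
    rw [Finset.prod_one_add, Finset.mul_sum]
    refine Finset.sum_congr rfl fun T _ => ?_
    rw [Finset.prod_neg, Finset.prod_inv_distrib, Nat.cast_prod]
    ring
  rw [hA, hB, ← Finset.sum_sub_distrib, Finset.prod_one_add, Finset.mul_sum]
  refine (Finset.abs_sum_le_sum_abs _ _).trans (Finset.sum_le_sum fun T hT => ?_)
  have hpos : 0 < ∏ p ∈ T, p :=
    Finset.prod_pos fun p hp => (hS p (Finset.mem_powerset.1 hT hp)).pos
  rw [← mul_sub, abs_mul, abs_pow, abs_neg, abs_one, one_pow, one_mul]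
  refine (abs_natDiv_sub_div_le_rpow x _ hpos h0 h1).trans_eq ?_
  rw [div_eq_mul_inv, Real.mul_rpow (by positivity) (by positivity), Nat.cast_prod,
    ← Finset.prod_inv_distrib, Real.finsetProd_rpow _ _ (fun p _ => by positivity)]

/-! ### Elementary bounds for products over small primes -/

lemma prime_of_mem_smallPrimes {β x : ℝ} {p : ℕ} (hp : p ∈ smallPrimes β x) : p.Prime :=
  (Finset.mem_filter.1 hp).2

lemma cast_le_of_mem_smallPrimes {β x : ℝ} {p : ℕ} (hp : p ∈ smallPrimes β x) :
    (p : ℝ) ≤ Real.exp (Real.log x ^ β) := by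
  have := Finset.mem_range.1 (Finset.mem_filter.1 hp).1
  exact (Nat.le_floor_iff (Real.exp_pos _).le).1 (Nat.lt_succ_iff.1 this)

lemma prod_Ioc_one_add_inv (N : ℕ) : ∏ m ∈ Finset.Ioc 0 N, (1 + (m : ℝ)⁻¹) = N + 1 := by
  induction N with
  | zero => simp
  | succ N ih =>
    rw [← Finset.insert_Ioc_right_eq_Ioc_add_one (Nat.zero_le N), Finset.prod_insert (by simp), ih]
    push_cast
    field_simp

lemma prod_Ioc_one_sub_inv (N : ℕ) :
    ∏ m ∈ Finset.Ioc 1 (N + 1), (1 - (m : ℝ)⁻¹) = ((N : ℝ) + 1)⁻¹ := by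
  induction N with
  | zero => simp
  | succ N ih =>
    rw [← Finset.insert_Ioc_right_eq_Ioc_add_one (by omega), Finset.prod_insert (by simp), ih]
    push_cast
    field_simp
    ring

/-- Extending the product to all integers up to `z` makes it telescope. Mertens would give order
`log z`, but any fixed power of `z = exp(L^β)` is harmless against `exp(L^(1-β))`. -/
lemma prod_smallPrimes_one_add_inv_le (β x : ℝ) (h : 0 ≤ Real.log x ^ β) :
    ∏ p ∈ smallPrimes β x, (1 + (p : ℝ)⁻¹) ≤ 2 * Real.exp (Real.log x ^ β) := by
  set z := Real.exp (Real.log x ^ β) with hz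
  have hz1 : 1 ≤ z := Real.one_le_exp h
  calc ∏ p ∈ smallPrimes β x, (1 + (p : ℝ)⁻¹)
      ≤ ∏ m ∈ Finset.Ioc 0 ⌊z⌋₊, (1 + (m : ℝ)⁻¹) := by
        refine Finset.prod_le_prod_of_subset_of_one_le (fun p hp => ?_) (fun _ _ => by positivity)
          (fun m _ _ => by simp)
        exact Finset.mem_Ioc.2 ⟨(prime_of_mem_smallPrimes hp).pos,
          Nat.le_floor (cast_le_of_mem_smallPrimes hp)⟩
    _ = ⌊z⌋₊ + 1 := prod_Ioc_one_add_inv _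
    _ ≤ 2 * z := by linarith [Nat.floor_le (zero_le_one.trans hz1)]

/-- The same telescoping, started at `m = 2` because the factor at `m = 1` vanishes. This lower
bound on the density turns additive errors into relative ones. -/
lemma one_le_sieveDensity_mul_exp (β x : ℝ) (h : 0 ≤ Real.log x ^ β) :
    1 ≤ sieveDensity β x * Real.exp (Real.log x ^ β) := by
  set z := Real.exp (Real.log x ^ β) with hz
  have hz1 : 1 ≤ z := Real.one_le_exp h
  obtain ⟨N, hN⟩ : ∃ N, ⌊z⌋₊ = N + 1 :=
    ⟨⌊z⌋₊ - 1, (Nat.sub_add_cancel (Nat.le_floor (by simpa using hz1))).symm⟩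
  have hNz : (N : ℝ) + 1 ≤ z := by
    have := Nat.floor_le (zero_le_one.trans hz1)
    rw [hN] at this
    exact_mod_cast this
  have hle : z⁻¹ ≤ sieveDensity β x := by
    calc z⁻¹ ≤ ((N : ℝ) + 1)⁻¹ := by gcongr
      _ = ∏ m ∈ Finset.Ioc 1 (N + 1), (1 - (m : ℝ)⁻¹) := (prod_Ioc_one_sub_inv N).symm
      _ ≤ ∏ p ∈ smallPrimes β x, (1 - (p : ℝ)⁻¹) := by
        refine Finset.prod_le_prod_of_subset_of_le_one (fun p hp => ?_) (fun m _ => ?_)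
          (fun m _ _ => ?_)
        · exact Finset.mem_Ioc.2 ⟨(prime_of_mem_smallPrimes hp).one_lt,
            hN ▸ Nat.le_floor (cast_le_of_mem_smallPrimes hp)⟩
        · exact sub_nonneg.2 (Nat.cast_inv_le_one m)
        · exact sub_le_self _ (by positivity)
  calc (1 : ℝ) = z⁻¹ * z := (inv_mul_cancel₀ (by positivity)).symm
    _ ≤ _ := by gcongr

lemma sieveDensity_nonneg (β x : ℝ) : 0 ≤ sieveDensity β x :=
  Finset.prod_nonneg fun p _ => sub_nonneg.2 (Nat.cast_inv_le_one p)

lemma sieveDensity_le_one (β x : ℝ) : sieveDensity β x ≤ 1 :=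
  Finset.prod_le_one (fun p _ => sub_nonneg.2 (Nat.cast_inv_le_one p))
    fun p _ => sub_le_self _ (by positivity)

lemma abs_card_coprime_smallPrimes_sub_le {β : ℝ} (hβ : 0 < β) {x n : ℕ}
    (hxn : x ≤ n) (hn : 1 ≤ Real.log n) :
    |(∑ m ∈ Finset.Ioc 0 x, if Nat.Coprime m (∏ p ∈ smallPrimes β n, p) then (1 : ℝ) else 0)
        - x * sieveDensity β n|
      ≤ n * (8 * Real.exp (3 * Real.log n ^ β - Real.log n ^ (1 - β))) := by
  set L := Real.log n with hL
  have hL0 : 0 < L := by linarith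
  have hn0 : (0 : ℝ) < n := by
    rcases Nat.eq_zero_or_pos n with rfl | h
    · simp at hL; linarith
    · exact_mod_cast h
  -- Rankin exponent `1 - δ`: this `δ` keeps `p ^ δ ≤ e` for every sieving prime, while `n ^ (-δ) =
  -- exp(-L^(1-β))`.
  set δ := L ^ (-β) with hδ
  have hδ0 : 0 ≤ δ := by positivity
  have hδ1 : δ ≤ 1 := Real.rpow_le_one_of_one_le_of_nonpos hn (by linarith)
  have hδz : L ^ β * δ = 1 := by
    rw [hδ, ← Real.rpow_add hL0]; simp
  have hδL : L * δ = L ^ (1 - β) := by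
    rw [hδ, sub_eq_add_neg, Real.rpow_add hL0, Real.rpow_one]
  refine (abs_card_coprime_sub_le (smallPrimes β n) (fun p => prime_of_mem_smallPrimes) x
    (sub_nonneg.2 hδ1) (sub_le_self _ hδ0)).trans ?_
  -- As `e ≤ 3`, each factor is at most `1 + 3/p ≤ (1 + 1/p)^3`.
  have hfac : ∀ p ∈ smallPrimes β (n : ℝ),
      1 + ((p : ℝ)⁻¹) ^ (1 - δ) ≤ (1 + (p : ℝ)⁻¹) ^ 3 := by
    intro p hp
    have hp0 : (0 : ℝ) < p := by exact_mod_cast (prime_of_mem_smallPrimes hp).pos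
    have h1 : (p : ℝ) ^ δ ≤ 3 := by
      calc (p : ℝ) ^ δ ≤ (Real.exp (L ^ β)) ^ δ :=
            Real.rpow_le_rpow hp0.le (cast_le_of_mem_smallPrimes hp) hδ0
        _ = Real.exp 1 := by rw [← Real.exp_mul, hδz]
        _ ≤ 3 := Real.exp_one_lt_three.le
    have h2 : ((p : ℝ)⁻¹) ^ (1 - δ) = (p : ℝ)⁻¹ * (p : ℝ) ^ δ := by
      rw [Real.inv_rpow hp0.le, ← Real.rpow_neg hp0.le, neg_sub, Real.rpow_sub hp0, Real.rpow_one]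
      field_simp
    have h3 : (p : ℝ)⁻¹ * (p : ℝ) ^ δ ≤ (p : ℝ)⁻¹ * 3 := by gcongr
    have h4 : 0 < (p : ℝ)⁻¹ := by positivity
    rw [h2]
    nlinarith [pow_pos h4 2, pow_pos h4 3]
  have hprod : ∏ p ∈ smallPrimes β (n : ℝ), (1 + ((p : ℝ)⁻¹) ^ (1 - δ))
      ≤ 8 * Real.exp (3 * L ^ β) := by
    calc _ ≤ ∏ p ∈ smallPrimes β (n : ℝ), (1 + (p : ℝ)⁻¹) ^ 3 :=
          Finset.prod_le_prod (fun p _ => by positivity) hfac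
      _ = (∏ p ∈ smallPrimes β (n : ℝ), (1 + (p : ℝ)⁻¹)) ^ 3 := Finset.prod_pow _ _ _
      _ ≤ (2 * Real.exp (L ^ β)) ^ 3 := by
          refine pow_le_pow_left₀ (Finset.prod_nonneg fun p _ => by positivity) ?_ 3
          exact prod_smallPrimes_one_add_inv_le β n (by positivity)
      _ = 8 * Real.exp (3 * L ^ β) := by
          rw [mul_pow, ← Real.exp_nat_mul]; norm_num
  have hx : (x : ℝ) ^ (1 - δ) ≤ n * Real.exp (-L ^ (1 - β)) := by
    calc (x : ℝ) ^ (1 - δ) ≤ (n : ℝ) ^ (1 - δ) :=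
          Real.rpow_le_rpow (by positivity) (by exact_mod_cast hxn) (sub_nonneg.2 hδ1)
      _ = n * Real.exp (-L ^ (1 - β)) := by
          rw [sub_eq_add_neg, Real.rpow_add hn0, Real.rpow_one, Real.rpow_def_of_pos hn0, ← hL,
            mul_neg, hδL]
  calc _ ≤ (n * Real.exp (-L ^ (1 - β))) * (8 * Real.exp (3 * L ^ β)) := by
        refine mul_le_mul hx hprod (Finset.prod_nonneg fun p _ => by positivity) (by positivity)
    _ = _ := by rw [sub_eq_add_neg (3 * L ^ β), Real.exp_add]; ring

/-! ### Counting visits of a lazy walk -/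

/-- Only times with `w i = 1` contribute, and at those times the positions run once through each
site below the endpoint. -/
lemma sum_indicator_mul_step (V : Set ℕ) (w : ℕ → ℕ) (hw : ∀ i, w i = 0 ∨ w i = 1) (n : ℕ) :
    ∑ i ∈ Finset.range n, V.indicator (fun _ => (1 : ℝ)) (∑ j ∈ Finset.range i, w j) * w i
      = ∑ m ∈ Finset.range (∑ j ∈ Finset.range n, w j), V.indicator (fun _ => (1 : ℝ)) m := by
  induction n with
  | zero => simp
  | succ n ih =>
    rw [Finset.sum_range_succ, ih, Finset.sum_range_succ w]
    rcases hw n with h | h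
    · simp [h]
    · simp [h, Finset.sum_range_succ]

/-- The sum of the centred steps `w i - α` over the times `i < n` at which the walk with
steps `w` is in `V`. -/
noncomputable def centredStepSum (V : Set ℕ) (α : ℝ) (w : ℕ → ℕ) (n : ℕ) : ℝ :=
  ∑ i ∈ Finset.range n,
    V.indicator (fun _ => (1 : ℝ)) (∑ j ∈ Finset.range i, w j) * (w i - α)

lemma centredStepSum_congr (V : Set ℕ) (α : ℝ) {w w' : ℕ → ℕ} {n : ℕ} (h : ∀ i < n, w i = w' i) :
    centredStepSum V α w n = centredStepSum V α w' n := by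
  refine Finset.sum_congr rfl fun i hi => ?_
  have hi' := Finset.mem_range.1 hi
  rw [h i hi', Finset.sum_congr rfl fun j hj => h j ((Finset.mem_range.1 hj).trans hi')]

lemma abs_indicator_one_mul_le (V : Set ℕ) (m : ℕ) (y : ℝ) :
    |V.indicator (fun _ => (1 : ℝ)) m * y| ≤ |y| := by
  by_cases h : m ∈ V <;> simp [h]

lemma abs_centredStepSum_le (V : Set ℕ) {α : ℝ} (h0 : 0 ≤ α) (h1 : α ≤ 1) {w : ℕ → ℕ}
    (hw : ∀ i, w i = 0 ∨ w i = 1) (n : ℕ) : |centredStepSum V α w n| ≤ n := by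
  refine (Finset.abs_sum_le_sum_abs _ _).trans ?_
  calc _ ≤ ∑ i ∈ Finset.range n, (1 : ℝ) := by
        refine Finset.sum_le_sum fun i _ => (abs_indicator_one_mul_le _ _ _).trans ?_
        rcases hw i with h | h <;> rw [h, abs_le] <;> push_cast <;> constructor <;> linarith
    _ = n := by simp

/-! ### Sub-Gaussian concentration of the centred step sums -/

section Probability

variable {Ω : Type*} [MeasurableSpace Ω] {μ : Measure Ω} {W : ℕ → Ω → ℕ}

lemma measurable_of_eq_of_forall_lt (hW : ∀ i, Measurable (W i)) (n : ℕ) (F : (ℕ → ℕ) → ℝ)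
    (hF : ∀ w w' : ℕ → ℕ, (∀ i < n, w i = w' i) → F w = F w') :
    Measurable fun ω => F fun i => W i ω := by
  have : (fun ω => F fun i => W i ω) = (fun v : Finset.range n → ℕ =>
      F fun i => if h : i ∈ Finset.range n then v ⟨i, h⟩ else 0) ∘
        (fun ω (i : Finset.range n) => W i ω) := by
    funext ω
    refine hF _ _ fun i hi => ?_
    simp [hi]
  rw [this]
  exact Measurable.of_discrete.comp (measurable_pi_lambda _ fun i => hW i)

/-- Independence of the past from the next step, which stands in for conditioning on a filtration.
`F` factors through the first `n` coordinates; the padding value `0` is irrelevant by `hF`. -/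
lemma indepFun_of_eq_of_forall_lt (hW : ∀ i, Measurable (W i)) (hind : iIndepFun W μ) (n : ℕ)
    (F : (ℕ → ℕ) → ℝ) (hF : ∀ w w' : ℕ → ℕ, (∀ i < n, w i = w' i) → F w = F w') (g : ℕ → ℝ) :
    IndepFun (fun ω => F fun i => W i ω) (fun ω => g (W n ω)) μ := by
  have h1 : (fun ω => F fun i => W i ω) = (fun v : Finset.range n → ℕ =>
      F fun i => if h : i ∈ Finset.range n then v ⟨i, h⟩ else 0) ∘
        (fun ω (i : Finset.range n) => W i ω) := by
    funext ω
    refine hF _ _ fun i hi => ?_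
    simp [hi]
  have h2 : (fun ω => g (W n ω)) = (fun v : ({n} : Finset ℕ) → ℕ =>
      g (v ⟨n, Finset.mem_singleton_self n⟩)) ∘ (fun ω (i : ({n} : Finset ℕ)) => W i ω) := rfl
  rw [h1, h2]
  exact (hind.indepFun_finset (Finset.range n) {n} (by simp) hW).comp
    Measurable.of_discrete Measurable.of_discrete

variable [IsProbabilityMeasure μ] {α : ℝ}

lemma ae_eq_zero_or_one (hW : ∀ i, Measurable (W i)) (h0 : 0 ≤ α) (h1 : α ≤ 1)
    (hW1 : ∀ i, μ {ω | W i ω = 1} = ENNReal.ofReal α)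
    (hW0 : ∀ i, μ {ω | W i ω = 0} = ENNReal.ofReal (1 - α)) :
    ∀ᵐ ω ∂μ, ∀ i, W i ω = 0 ∨ W i ω = 1 := by
  rw [ae_all_iff]
  intro i
  have hm0 : MeasurableSet {ω | W i ω = 0} := hW i (measurableSet_singleton 0)
  have hm1 : MeasurableSet {ω | W i ω = 1} := hW i (measurableSet_singleton 1)
  have hdis : Disjoint {ω | W i ω = 0} {ω | W i ω = 1} := by
    rw [Set.disjoint_left]
    intro ω h h'
    simp_all
  have hu : μ ({ω | W i ω = 0} ∪ {ω | W i ω = 1}) = 1 := by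
    rw [measure_union hdis hm1, hW0, hW1, ← ENNReal.ofReal_add (by linarith) h0]
    simp
  exact (prob_compl_eq_zero_iff (hm0.union hm1)).2 hu

lemma integral_step (hW : ∀ i, Measurable (W i)) (h0 : 0 ≤ α) (h1 : α ≤ 1)
    (hW1 : ∀ i, μ {ω | W i ω = 1} = ENNReal.ofReal α)
    (hW0 : ∀ i, μ {ω | W i ω = 0} = ENNReal.ofReal (1 - α)) (i : ℕ) :
    ∫ ω, (W i ω : ℝ) ∂μ = α := by
  have h : (fun ω => (W i ω : ℝ)) =ᵐ[μ] {ω | W i ω = 1}.indicator (fun _ => (1 : ℝ)) := by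
    filter_upwards [ae_eq_zero_or_one hW h0 h1 hW1 hW0] with ω hω
    rcases hω i with h | h <;> simp [h, Set.indicator]
  have hm : MeasurableSet {ω | W i ω = 1} := hW i (measurableSet_singleton 1)
  rw [integral_congr_ae h, integral_indicator_const _ hm, measureReal_def, hW1, ENNReal.toReal_ofReal h0, smul_eq_mul, mul_one]

/-- Hoeffding's lemma on an interval of length `1`: variance proxy `1/4`, hence `t ^ 2 / 8`. -/
lemma mgf_centred_step_le (hW : ∀ i, Measurable (W i)) (h0 : 0 ≤ α) (h1 : α ≤ 1)
    (hW1 : ∀ i, μ {ω | W i ω = 1} = ENNReal.ofReal α)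
    (hW0 : ∀ i, μ {ω | W i ω = 0} = ENNReal.ofReal (1 - α)) (i : ℕ) (t : ℝ) :
    ∫ ω, Real.exp (t * (W i ω - α)) ∂μ ≤ Real.exp (t ^ 2 / 8) := by
  have hb : ∀ᵐ ω ∂μ, (W i ω : ℝ) ∈ Set.Icc (0 : ℝ) 1 := by
    filter_upwards [ae_eq_zero_or_one hW h0 h1 hW1 hW0] with ω hω
    rcases hω i with h | h <;> simp [h]
  have hm : Measurable fun ω => (W i ω : ℝ) := measurable_from_nat.comp (hW i)
  have h := (hasSubgaussianMGF_of_mem_Icc hm.aemeasurable hb).mgf_le t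
  rw [integral_step hW h0 h1 hW1 hW0] at h
  refine h.trans (Real.exp_le_exp.2 (le_of_eq ?_))
  simp
  ring

/-- Whether step `n` is counted depends only on earlier steps. Each step therefore multiplies the
moment generating function by at most `exp(t ^ 2 / 8)`. -/
lemma hasSubgaussianMGF_centredStepSum (hW : ∀ i, Measurable (W i)) (hind : iIndepFun W μ)
    (h0 : 0 ≤ α) (h1 : α ≤ 1)
    (hW1 : ∀ i, μ {ω | W i ω = 1} = ENNReal.ofReal α)
    (hW0 : ∀ i, μ {ω | W i ω = 0} = ENNReal.ofReal (1 - α)) (V : Set ℕ) (n : ℕ) :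
    HasSubgaussianMGF (fun ω => centredStepSum V α (fun i => W i ω) n) (n / 4) μ := by
  have hmeas : ∀ n, Measurable fun ω => centredStepSum V α (fun i => W i ω) n := fun n =>
    measurable_of_eq_of_forall_lt hW n _ fun _ _ h => centredStepSum_congr V α h
  have hint : ∀ n t, Integrable
      (fun ω => Real.exp (t * centredStepSum V α (fun i => W i ω) n)) μ := by
    intro n t
    refine integrable_exp_mul_of_mem_Icc (a := -n) (b := n) (hmeas n).aemeasurable ?_
    filter_upwards [ae_eq_zero_or_one hW h0 h1 hW1 hW0] with ω hω
    exact abs_le.1 (abs_centredStepSum_le V h0 h1 hω n)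
  refine ⟨hint n, fun t => ?_⟩
  induction n with
  | zero => simp [centredStepSum, mgf]
  | succ n ih =>
    set X : (ℕ → ℕ) → ℝ := fun w => V.indicator (fun _ => (1 : ℝ)) (∑ j ∈ Finset.range n, w j)
      with hX
    -- `A` and `B` are the parts of the exponential with the walk outside and inside `V` at time
    -- `n`; only `B` acquires the factor from the new step.
    set A : (ℕ → ℕ) → ℝ := fun w => Real.exp (t * centredStepSum V α w n) * (1 - X w) with hA
    set B : (ℕ → ℕ) → ℝ := fun w => Real.exp (t * centredStepSum V α w n) * X w with hB
    have hX01 : ∀ w, X w = 0 ∨ X w = 1 := fun w => by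
      simp only [hX, Set.indicator]
      split_ifs <;> simp
    have hXc : ∀ w w' : ℕ → ℕ, (∀ i < n, w i = w' i) → X w = X w' := fun w w' h => by
      simp only [hX]
      rw [Finset.sum_congr rfl fun j hj => h j (Finset.mem_range.1 hj)]
    have hAc : ∀ w w' : ℕ → ℕ, (∀ i < n, w i = w' i) → A w = A w' := fun w w' h => by
      simp only [hA]
      rw [centredStepSum_congr V α h, hXc _ _ h]
    have hBc : ∀ w w' : ℕ → ℕ, (∀ i < n, w i = w' i) → B w = B w' := fun w w' h => by
      simp only [hB]
      rw [centredStepSum_congr V α h, hXc _ _ h]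
    have hAm := measurable_of_eq_of_forall_lt hW n A hAc
    have hBm := measurable_of_eq_of_forall_lt hW n B hBc
    have hAi : Integrable (fun ω => A fun i => W i ω) μ := by
      refine (hint n t).mono hAm.aestronglyMeasurable (ae_of_all _ fun ω => ?_)
      rcases hX01 fun i => W i ω with h | h <;> simp only [hA, h] <;> simp [Real.exp_nonneg]
    have hBi : Integrable (fun ω => B fun i => W i ω) μ := by
      refine (hint n t).mono hBm.aestronglyMeasurable (ae_of_all _ fun ω => ?_)
      rcases hX01 fun i => W i ω with h | h <;> simp only [hB, h] <;> simp [Real.exp_nonneg]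
    have hA0 : ∀ w, 0 ≤ A w := fun w =>
      mul_nonneg (Real.exp_pos _).le (by rcases hX01 w with h | h <;> simp [h])
    have hB0 : ∀ w, 0 ≤ B w := fun w =>
      mul_nonneg (Real.exp_pos _).le (by rcases hX01 w with h | h <;> simp [h])
    have hE : Measurable fun ω => Real.exp (t * ((W n ω : ℝ) - α)) :=
      (measurable_from_nat (f := fun m : ℕ => Real.exp (t * ((m : ℝ) - α)))).comp (hW n)
    have hsplit : ∀ ω, Real.exp (t * centredStepSum V α (fun i => W i ω) (n + 1))
        = A (fun i => W i ω) + B (fun i => W i ω) * Real.exp (t * (W n ω - α)) := by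
      intro ω
      have hs : centredStepSum V α (fun i => W i ω) (n + 1)
          = centredStepSum V α (fun i => W i ω) n + X (fun i => W i ω) * (W n ω - α) :=
        Finset.sum_range_succ _ _
      rw [hs]
      rcases hX01 fun i => W i ω with h | h
      · simp [hA, hB, h]
      · simp [hA, hB, h, mul_add, Real.exp_add]
    have hBEi : Integrable
        (fun ω => B (fun i => W i ω) * Real.exp (t * (W n ω - α))) μ := by
      have := (hint (n + 1) t).sub hAi
      refine this.congr (ae_of_all _ fun ω => ?_)
      simp [hsplit]
    have hindep := indepFun_of_eq_of_forall_lt hW hind n B hBc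
      (fun m : ℕ => Real.exp (t * ((m : ℝ) - α)))
    have hstep := mgf_centred_step_le hW h0 h1 hW1 hW0 n t
    have hone : 1 ≤ Real.exp (t ^ 2 / 8) := Real.one_le_exp (by positivity)
    have hIA : 0 ≤ ∫ ω, A fun i => W i ω ∂μ := integral_nonneg fun ω => hA0 _
    have hIB : 0 ≤ ∫ ω, B fun i => W i ω ∂μ := integral_nonneg fun ω => hB0 _
    calc mgf (fun ω => centredStepSum V α (fun i => W i ω) (n + 1)) μ t
        = (∫ ω, A fun i => W i ω ∂μ)
            + (∫ ω, B fun i => W i ω ∂μ) * ∫ ω, Real.exp (t * (W n ω - α)) ∂μ := by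
          rw [mgf]
          simp_rw [hsplit]
          rw [integral_add hAi hBEi, hindep.integral_fun_mul_eq_mul_integral
            hBm.aestronglyMeasurable hE.aestronglyMeasurable]
      _ ≤ (∫ ω, A fun i => W i ω ∂μ) * Real.exp (t ^ 2 / 8)
            + (∫ ω, B fun i => W i ω ∂μ) * Real.exp (t ^ 2 / 8) := by
          gcongr
          exact le_mul_of_one_le_right hIA hone
      _ = mgf (fun ω => centredStepSum V α (fun i => W i ω) n) μ t * Real.exp (t ^ 2 / 8) := by
          rw [← add_mul, ← integral_add hAi hBi, mgf]
          congr 2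
          funext ω
          simp only [hA, hB]
          ring
      _ ≤ Real.exp ((n / 4 : NNReal) * t ^ 2 / 2) * Real.exp (t ^ 2 / 8) := by
          gcongr
      _ = Real.exp (((n + 1 : ℕ) / 4 : NNReal) * t ^ 2 / 2) := by
          rw [← Real.exp_add]
          push_cast
          ring_nf

lemma summable_exp_neg_two_mul_sqrt : Summable fun n : ℕ => Real.exp (-(2 * √(n : ℝ))) := by
  refine Summable.of_norm_bounded_eventually_nat
    ((Real.summable_nat_pow_inv.2 one_lt_two).mul_left 2) ?_
  filter_upwards [eventually_gt_atTop 0] with n hn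
  have hn' : (0 : ℝ) < n := by exact_mod_cast hn
  -- The fourth-order term of the exponential series gives `exp(2√n) ≥ 16 n^2 / 24 ≥ n^2 / 2`.
  have h := Real.pow_div_factorial_le_exp (2 * √(n : ℝ)) (by positivity) 4
  have h4 : (2 * √(n : ℝ)) ^ 4 = 16 * (n : ℝ) ^ 2 := by
    calc (2 * √(n : ℝ)) ^ 4 = 16 * (√(n : ℝ) ^ 2) ^ 2 := by ring
      _ = _ := by rw [Real.sq_sqrt hn'.le]
  rw [h4] at h
  rw [Real.norm_eq_abs, Real.abs_exp, Real.exp_neg, ← div_eq_mul_inv,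
    inv_le_comm₀ (Real.exp_pos _) (by positivity), inv_div]
  refine le_trans ?_ h
  norm_num [Nat.factorial]
  nlinarith [pow_pos hn' 2]

/-- Borel–Cantelli for the martingales `centredStepSum (V n) α W`. -/
lemma ae_eventually_abs_centredStepSum_lt (hW : ∀ i, Measurable (W i)) (hind : iIndepFun W μ)
    (h0 : 0 ≤ α) (h1 : α ≤ 1)
    (hW1 : ∀ i, μ {ω | W i ω = 1} = ENNReal.ofReal α)
    (hW0 : ∀ i, μ {ω | W i ω = 0} = ENNReal.ofReal (1 - α)) (V : ℕ → Set ℕ) :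
    ∀ᵐ ω ∂μ, ∀ᶠ n : ℕ in atTop,
      |centredStepSum (V n) α (fun i => W i ω) n| < (n : ℝ) ^ (3 / 4 : ℝ) := by
  -- The tail exponent is `n^(3/2) / (n/2) = 2√n`; at `n = 0` both sides are `exp 0`, since `0 / 0 =
  -- 0`.
  have hexp : ∀ n : ℕ, Real.exp (-((n : ℝ) ^ (3 / 4 : ℝ)) ^ 2 / (2 * (n / 4 : NNReal)))
      ≤ Real.exp (-(2 * √(n : ℝ))) := by
    intro n
    refine Real.exp_le_exp.2 (le_of_eq ?_)
    rcases Nat.eq_zero_or_pos n with rfl | hn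
    · simp
    have hn' : (0 : ℝ) < n := by exact_mod_cast hn
    have h2 : ((n : ℝ) ^ (3 / 4 : ℝ)) ^ 2 = n * √(n : ℝ) := by
      rw [← Real.rpow_natCast, ← Real.rpow_mul hn'.le, Real.sqrt_eq_rpow]
      nth_rewrite 2 [← Real.rpow_one (n : ℝ)]
      rw [← Real.rpow_add hn']
      norm_num
    rw [h2]
    push_cast
    field_simp
    norm_num
  have hbound : ∀ n : ℕ, μ {ω | (n : ℝ) ^ (3 / 4 : ℝ) ≤
      |centredStepSum (V n) α (fun i => W i ω) n|}
        ≤ ENNReal.ofReal (2 * Real.exp (-(2 * √(n : ℝ)))) := by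
    intro n
    have hs := hasSubgaussianMGF_centredStepSum hW hind h0 h1 hW1 hW0 (V n) n
    have hε : (0 : ℝ) ≤ (n : ℝ) ^ (3 / 4 : ℝ) := by positivity
    have h1 := (hs.measure_ge_le hε).trans (hexp n)
    have h2 := (hs.neg.measure_ge_le hε).trans (hexp n)
    rw [← ofReal_measureReal]
    refine ENNReal.ofReal_le_ofReal ?_
    have hsub : {ω | (n : ℝ) ^ (3 / 4 : ℝ) ≤ |centredStepSum (V n) α (fun i => W i ω) n|} ⊆
        {ω | (n : ℝ) ^ (3 / 4 : ℝ) ≤ centredStepSum (V n) α (fun i => W i ω) n} ∪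
          {ω | (n : ℝ) ^ (3 / 4 : ℝ) ≤
            (-fun ω => centredStepSum (V n) α (fun i => W i ω) n) ω} :=
      fun ω hω => by
        simp only [Set.mem_union, Set.mem_ofPred_eq, Pi.neg_apply] at hω ⊢
        exact le_abs.1 hω
    linarith [(measureReal_mono hsub).trans (measureReal_union_le (μ := μ) _ _)]
  have hsum := (summable_exp_neg_two_mul_sqrt.mul_left 2).tsum_ofReal_ne_top
  filter_upwards [ae_eventually_notMem (ne_top_of_le_ne_top hsum (ENNReal.tsum_le_tsum hbound))]
    with ω hω
  filter_upwards [hω] with n hn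
  exact not_le.1 hn

end Probability

/-! ### The proportion of time spent in the sieved set -/

/-- The two sums differ by `f N - f 0`. This serves both for sites and for shifting the times `0, …,
n - 1` to `1, …, n`. -/
lemma abs_sum_Ioc_sub_sum_range_le_one (f : ℕ → ℝ) (h0 : ∀ m, 0 ≤ f m) (h1 : ∀ m, f m ≤ 1)
    (N : ℕ) : |∑ m ∈ Finset.Ioc 0 N, f m - ∑ m ∈ Finset.range N, f m| ≤ 1 := by
  have h : ∑ m ∈ Finset.Ioc 0 N, f m = ∑ m ∈ Finset.range N, f m + f N - f 0 := by
    induction N with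
    | zero => simp
    | succ N ih =>
      rw [← Finset.insert_Ioc_right_eq_Ioc_add_one (Nat.zero_le N), Finset.sum_insert (by simp),
        ih, Finset.sum_range_succ]
      ring
  rw [h, abs_le]
  constructor <;> linarith [h0 0, h0 N, h1 0, h1 N]

lemma indicator_one_nonneg (V : Set ℕ) (m : ℕ) : 0 ≤ V.indicator (fun _ => (1 : ℝ)) m :=
  Set.indicator_nonneg (fun _ _ => zero_le_one) m

lemma indicator_one_le_one (V : Set ℕ) (m : ℕ) : V.indicator (fun _ => (1 : ℝ)) m ≤ 1 :=
  Set.indicator_le_self' (fun _ _ => zero_le_one) m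

lemma abs_sum_indicator_sievedSet_sub_le {β : ℝ} (hβ : 0 < β) {x n : ℕ} (hxn : x ≤ n)
    (hn : 1 ≤ Real.log n) :
    |∑ m ∈ Finset.range x, (sievedSet β n).indicator (fun _ => (1 : ℝ)) m - x * sieveDensity β n|
      ≤ n * (8 * Real.exp (3 * Real.log n ^ β - Real.log n ^ (1 - β))) + 1 := by
  have h1 := abs_card_coprime_smallPrimes_sub_le hβ hxn hn
  have h2 := abs_sum_Ioc_sub_sum_range_le_one _ (indicator_one_nonneg (sievedSet β n))
    (indicator_one_le_one _) x
  have h3 : ∑ m ∈ Finset.Ioc 0 x, (sievedSet β n).indicator (fun _ => (1 : ℝ)) m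
      = ∑ m ∈ Finset.Ioc 0 x,
        if Nat.Coprime m (∏ p ∈ smallPrimes β n, p) then (1 : ℝ) else 0 := by
    refine Finset.sum_congr rfl fun m hm => ?_
    have hmn : m ≤ n := (Finset.mem_Ioc.1 hm).2.trans hxn
    simp [Set.indicator, sievedSet, hmn]
  rw [h3] at h2
  rw [abs_le] at h1 h2 ⊢
  constructor <;> linarith [h1.1, h1.2, h2.1, h2.2]

lemma centredStepSum_univ (α : ℝ) (w : ℕ → ℕ) (n : ℕ) :
    centredStepSum Set.univ α w n = (∑ j ∈ Finset.range n, w j : ℕ) - n * α := by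
  simp [centredStepSum]

lemma centredStepSum_eq (V : Set ℕ) (α : ℝ) (w : ℕ → ℕ) (hw : ∀ i, w i = 0 ∨ w i = 1) (n : ℕ) :
    centredStepSum V α w n
      = ∑ m ∈ Finset.range (∑ j ∈ Finset.range n, w j), V.indicator (fun _ => (1 : ℝ)) m
        - α * ∑ i ∈ Finset.range n,
            V.indicator (fun _ => (1 : ℝ)) (∑ j ∈ Finset.range i, w j) := by
  rw [← sum_indicator_mul_step V w hw, centredStepSum, Finset.mul_sum, ← Finset.sum_sub_distrib]
  exact Finset.sum_congr rfl fun i _ => by ring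

lemma abs_visitProportion_sub_le {α β : ℝ} (hα0 : 0 < α) (hα1 : α ≤ 1) (hβ : 0 < β)
    {w : ℕ → ℕ} (hw : ∀ i, w i = 0 ∨ w i = 1) {n : ℕ} (hn : 1 ≤ Real.log n)
    (hV : |centredStepSum (sievedSet β n) α w n| < (n : ℝ) ^ (3 / 4 : ℝ))
    (hU : |centredStepSum Set.univ α w n| < (n : ℝ) ^ (3 / 4 : ℝ)) :
    |visitProportion (fun i => ∑ j ∈ Finset.range i, w j) (sievedSet β n) n - sieveDensity β n|
      ≤ (α⁻¹ * (8 * Real.exp (4 * Real.log n ^ β - Real.log n ^ (1 - β))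
          + 4 * Real.exp (Real.log n ^ β - 1 / 4 * Real.log n ^ (1 : ℝ)))) *
        sieveDensity β n := by
  set L := Real.log n with hL
  set c := sieveDensity β n with hc
  set X := ∑ j ∈ Finset.range n, w j with hX
  have hn1 : (1 : ℝ) ≤ n := by
    rcases Nat.eq_zero_or_pos n with rfl | h
    · simp at hL; linarith
    · exact_mod_cast h
  have hXn : X ≤ n := by
    calc X ≤ ∑ j ∈ Finset.range n, 1 :=
          Finset.sum_le_sum fun j _ => by rcases hw j with h | h <;> simp [h]
      _ = n := by simp
  have hpow : (n : ℝ) ^ (3 / 4 : ℝ) = n * Real.exp (-(1 / 4 * L)) := by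
    rw [show (3 / 4 : ℝ) = 1 + -(1 / 4) by norm_num, Real.rpow_add (by linarith), Real.rpow_one,
      Real.rpow_def_of_pos (by linarith), ← hL]
    ring_nf
  have hpow1 : 1 ≤ (n : ℝ) ^ (3 / 4 : ℝ) := Real.one_le_rpow hn1 (by norm_num)
  have hS := abs_sum_indicator_sievedSet_sub_le hβ hXn hn
  rw [centredStepSum_eq _ _ _ hw] at hV
  rw [centredStepSum_univ] at hU
  have hvis := abs_sum_Ioc_sub_sum_range_le_one
    (fun i => (sievedSet β n).indicator (fun _ => (1 : ℝ)) (∑ j ∈ Finset.range i, w j))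
    (fun _ => indicator_one_nonneg _ _) (fun _ => indicator_one_le_one _ _) n
  have hIcc : Finset.Icc 1 n = Finset.Ioc 0 n := rfl
  have hnv : visitProportion (fun i => ∑ j ∈ Finset.range i, w j) (sievedSet β n) n * n
      = ∑ i ∈ Finset.Ioc 0 n,
        (sievedSet β n).indicator (fun _ => (1 : ℝ)) (∑ j ∈ Finset.range i, w j) := by
    rw [visitProportion, hIcc, div_mul_cancel₀ _ (by positivity)]
  rw [← hnv] at hvis
  set v := visitProportion (fun i => ∑ j ∈ Finset.range i, w j) (sievedSet β n) n
  set A := ∑ i ∈ Finset.range n,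
    (sievedSet β n).indicator (fun _ => (1 : ℝ)) (∑ j ∈ Finset.range i, w j)
  set N := ∑ m ∈ Finset.range X, (sievedSet β n).indicator (fun _ => (1 : ℝ)) m
  set E := 8 * Real.exp (3 * L ^ β - L ^ (1 - β)) with hE
  have hc0 : 0 ≤ c := sieveDensity_nonneg β n
  have hc1 : c ≤ 1 := sieveDensity_le_one β n
  have hcU : |c * (X - n * α)| ≤ (n : ℝ) ^ (3 / 4 : ℝ) := by
    rw [abs_mul, abs_of_nonneg hc0]
    exact (mul_le_of_le_one_left (abs_nonneg _) hc1).trans hU.le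
  have hαv : |α * (v * n - A)| ≤ 1 := by
    rw [abs_mul, abs_of_pos hα0]
    exact (mul_le_of_le_one_left (abs_nonneg _) hα1).trans hvis
  -- Here `M` is the centred sum over the sieved set, and `α n (v - c) = α (v n - A) - M + (N - X c)
  -- + c (X - n α)`. The two errors of size `1`, from shifting times and sites, are absorbed using
  -- `1 ≤ n ^ (3/4)`.
  have hmain : |(α * n) * (v - c)| ≤ n * E + 4 * (n : ℝ) ^ (3 / 4 : ℝ) := by
    rw [abs_le] at hαv hcU hS ⊢
    rw [abs_lt] at hV
    constructor <;> nlinarith [hαv.1, hαv.2, hcU.1, hcU.2, hV.1, hV.2, hS.1, hS.2]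
  have hz : 1 ≤ c * Real.exp (L ^ β) := one_le_sieveDensity_mul_exp β n (by positivity)
  have hfin : |v - c| ≤ α⁻¹ * (E + 4 * Real.exp (-(1 / 4 * L))) := by
    rw [abs_mul, abs_of_pos (by positivity : 0 < α * n), hpow] at hmain
    rw [inv_mul_eq_div, le_div_iff₀ hα0]
    refine le_of_mul_le_mul_left ?_ (by positivity : (0 : ℝ) < n)
    linarith
  calc |v - c| ≤ α⁻¹ * (E + 4 * Real.exp (-(1 / 4 * L))) * 1 := by rwa [mul_one]
    _ ≤ α⁻¹ * (E + 4 * Real.exp (-(1 / 4 * L))) * (c * Real.exp (L ^ β)) := by gcongr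
    _ = _ := by
      rw [hE, show 4 * L ^ β - L ^ (1 - β) = L ^ β + (3 * L ^ β - L ^ (1 - β)) by ring,
        Real.exp_add, sub_eq_add_neg (L ^ β), Real.exp_add, Real.rpow_one]
      ring

/-- The exponent is `x ^ b * (C * x ^ (a - b) - D)`, whose second factor tends to `-D < 0`. -/
lemma tendsto_exp_mul_rpow_sub_mul_rpow {a b C D : ℝ} (hb : 0 < b) (hab : a < b) (hD : 0 < D) :
    Tendsto (fun x : ℝ => Real.exp (C * x ^ a - D * x ^ b)) atTop (nhds 0) := by
  refine Real.tendsto_exp_atBot.comp ?_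
  have h1 : Tendsto (fun x : ℝ => C * x ^ (a - b) - D) atTop (nhds (C * 0 - D)) := by
    have := tendsto_rpow_neg_atTop (sub_pos.2 hab)
    rw [neg_sub] at this
    exact (this.const_mul C).sub_const D
  refine ((tendsto_rpow_atTop hb).atTop_mul_neg (by simpa using hD) h1).congr' ?_
  filter_upwards [eventually_gt_atTop 0] with x hx
  rw [Real.rpow_sub hx]
  field_simp

theorem theorem1p3 {Ω : Type*} [MeasurableSpace Ω] (μ : Measure Ω) [IsProbabilityMeasure μ]
    (α : ℝ) (hα0 : 0 < α) (hα1 : α < 1) (β : ℝ) (hβ0 : 0 < β) (hβ1 : β < 1 / 2)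
    (P : ℕ → Ω → ℕ) (hP : IsAlphaRandomWalk μ α P) :
    ∀ᵐ ω ∂μ,
      (fun n : ℕ => visitProportion (fun i => P i ω) (sievedSet β n) n)
        ~[atTop] (fun n : ℕ => sieveDensity β n) := by
  obtain ⟨W, hW, hind, hW1, hW0, hP0, hPs⟩ := hP
  have hPW : ∀ ω i, P i ω = ∑ j ∈ Finset.range i, W j ω := by
    intro ω i
    induction i with
    | zero => simpa using hP0 ω
    | succ i ih => rw [hPs, ih, Finset.sum_range_succ]
  have hlog : Tendsto (fun n : ℕ => Real.log n) atTop atTop :=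
    Real.tendsto_log_atTop.comp tendsto_natCast_atTop_atTop
  have hlim : Tendsto (fun n : ℕ => α⁻¹ *
      (8 * Real.exp (4 * Real.log n ^ β - Real.log n ^ (1 - β))
        + 4 * Real.exp (Real.log n ^ β - 1 / 4 * Real.log n ^ (1 : ℝ)))) atTop (nhds 0) := by
    -- The condition `β < 1 / 2` is decisive here: it gives `β < 1 - β`.
    have h1 := (tendsto_exp_mul_rpow_sub_mul_rpow (C := 4) (D := 1) (a := β) (b := 1 - β)
      (by linarith) (by linarith) one_pos).comp hlog
    have h2 := (tendsto_exp_mul_rpow_sub_mul_rpow (C := 1) (D := 1 / 4) (a := β) (b := 1)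
      one_pos (by linarith) (by norm_num)).comp hlog
    simpa [Function.comp_def] using ((h1.const_mul 8).add (h2.const_mul 4)).const_mul α⁻¹
  filter_upwards [ae_eq_zero_or_one hW hα0.le hα1.le hW1 hW0,
    ae_eventually_abs_centredStepSum_lt hW hind hα0.le hα1.le hW1 hW0
      (fun n => sievedSet β (n : ℝ)),
    ae_eventually_abs_centredStepSum_lt hW hind hα0.le hα1.le hW1 hW0
      (fun _ => Set.univ)] with ω hω hV hU
  refine IsLittleO.of_bound fun ε hε => ?_
  filter_upwards [hV, hU, hlog.eventually_ge_atTop 1, hlim.eventually_le_const hε]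
    with n hVn hUn hn hnε
  simp only [hPW, Pi.sub_apply, Real.norm_eq_abs]
  rw [abs_of_nonneg (sieveDensity_nonneg β n)]
  exact (abs_visitProportion_sub_le hα0 hα1.le hβ0 hω hn hVn hUn).trans
    (mul_le_mul_of_nonneg_right hnε (sieveDensity_nonneg β n))
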